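/- Let $\mathbb F_q$ be a finite field with $q$ elements, let $0<\epsilon<1$, and let $1\le M<T$ be integers. Consider a line network of $L\ge 1$ identical packet erasure channels with erasure probability $\epsilon$: a channel input is a packet in $\mathbb F_q^T$ or the erasure symbol $e$; a packet is received unchanged with probability $1-\epsilon$ and as $e$ with probability $\epsilon$, the input $e$ is always received as $e$, and all channel uses are independent. A batch consists of $M$ packets $x_1,\dots,x_M\in\mathbb F_q^T$ for which the $M\times M$ matrix formed by the first $M$ symbols of each packet (as columns) is the identity. Under random linear recoding with inner block-length $N\ge 1$, the source node sends, over the first channel, $N$ random linear combinations of the $M$ packets of the batch, and each of the $L-1$ intermediate nodes sends, over the next channel, $N$ random linear combinations of the $N$ packets it received, an erasure being read as the all-zero packet; all coefficients are independent and uniform on $\mathbb F_q$. Let $\mathbf E[\pi_L]$ be the expected rank of the $M\times N$ coefficient matrix formed by the first $M$ symbols of each of the $N$ packets received at the destination node, and let $$\mathrm{BATS}_L(M,N)=\Bigl(1-\frac MT\Bigr)\frac{\mathbf E[\pi_L]}{N}\,\log_2\bigl(q^T\bigr)$$ be the achievable rate of BATS codes in bits per use of the network. Then $$\mathrm{BATS}_L(M,N)=\Theta\!\left(\frac{\bigl(1-(\epsilon+(1-\epsilon)/q)^N\bigr)^L}{N}\right),$$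 that is, there are constants $c,C>0$, depending only on $\mathbb F_q$, $\epsilon$, $T$ and $M$, such that for all $L\ge 1$ and $N\ge 1$ and every such batch $$c\,\frac{\bigl(1-(\epsilon+(1-\epsilon)/q)^N\bigr)^L}{N}\le \mathrm{BATS}_L(M,N)\le C\,\frac{\bigl(1-(\epsilon+(1-\epsilon)/q)^N\bigr)^L}{N}.$$ -/

import Mathlib

/-! Batched codes with random linear recoding over a line network of packet erasure channels.
All alphabets are finite, and a transition matrix `W` is a real matrix whose entry `W x y` is the
probability of the output `y` given the input `x`. -/

namespace BatchedCode

/-- A packet: a vector of `T` symbols of `F`. -/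
abbrev Packet (F : Type*) (T : ℕ) : Type _ := Fin T → F

/-- The transition matrix of the packet erasure channel with erasure probability `ε`; input and
output alphabet are `A ∪ {e}`, where the erasure `e` is `none`. -/
def erasureChannel {A : Type*} [DecidableEq A] (ε : ℝ) : Matrix (Option A) (Option A) ℝ
  | some x, some y => if y = x then 1 - ε else 0
  | some _, none => ε
  | none, some _ => 0
  | none, none => 1

/-- `N` independent uses of a memoryless channel. -/
def channelUses {I O : Type*} (Q : Matrix I O ℝ) (N : ℕ) : Matrix (Fin N → I) (Fin N → O) ℝ :=
  fun u y => ∏ i, Q (u i) (y i)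

/-- The `N` linear combinations of the packets `p 0, …, p (K-1)` with coefficients `G`. -/
def combine {F : Type*} [Field F] {T K N : ℕ} (G : Matrix (Fin K) (Fin N) F)
    (p : Fin K → Packet F T) : Fin N → Packet F T :=
  fun j => ∑ k, G k j • p k

/-- Random linear recoding of `K` packets into `N` channel inputs: the probability of `u` when the
`K * N` coefficients are independent and uniform on `F`. -/
noncomputable def randomRecoding {F : Type*} [Field F] [Fintype F] [DecidableEq F] {T K : ℕ}
    (N : ℕ) (p : Fin K → Packet F T) (u : Fin N → Option (Packet F T)) : ℝ :=
  (Fintype.card {G : Matrix (Fin K) (Fin N) F // (fun j => some (combine G p j)) = u} : ℝ) /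
    (Fintype.card (Matrix (Fin K) (Fin N) F) : ℝ)

/-- The packets that a node works with: an erasure is read as the all-zero packet. -/
def received {F : Type*} [Field F] {T N : ℕ} (y : Fin N → Option (Packet F T)) :
    Fin N → Packet F T :=
  fun j => (y j).getD 0

/-- Recoding at the source node: from the `M` packets of the batch to `N` channel inputs. -/
noncomputable def sourceRecoding (F : Type*) [Field F] [Fintype F] [DecidableEq F] (T M N : ℕ) :
    Matrix (Fin M → Packet F T) (Fin N → Option (Packet F T)) ℝ :=
  fun x u => randomRecoding N x u

/-- Recoding at an intermediate node: from `N` channel outputs to `N` channel inputs. -/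
noncomputable def nodeRecoding (F : Type*) [Field F] [Fintype F] [DecidableEq F] (T N : ℕ) :
    Matrix (Fin N → Option (Packet F T)) (Fin N → Option (Packet F T)) ℝ :=
  fun y u => randomRecoding N (received y) u

/-- `N` independent uses of the erasure channel whose input packets are vectors in `F ^ T`. -/
def erasureUses (F : Type*) [DecidableEq F] (T N : ℕ) (ε : ℝ) :
    Matrix (Fin N → Option (Packet F T)) (Fin N → Option (Packet F T)) ℝ :=
  channelUses (erasureChannel ε) N

/-- The end-to-end transition matrix `F Q Φ Q Φ ⋯ Φ Q`, with `L ≥ 1` channels and `L - 1`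
intermediate nodes, from a batch to the `N` outputs of the last channel. -/
noncomputable def endToEnd (F : Type*) [Field F] [Fintype F] [DecidableEq F] (T M N : ℕ) (ε : ℝ)
    (L : ℕ) : Matrix (Fin M → Packet F T) (Fin N → Option (Packet F T)) ℝ :=
  sourceRecoding F T M N * erasureUses F T N ε *
    (nodeRecoding F T N * erasureUses F T N ε) ^ (L - 1)

/-- The coefficient matrix of `K` packets: the first `M` symbols of each packet, as columns. -/
def coefficientMatrix {F : Type*} {T M K : ℕ} (hMT : M ≤ T) (p : Fin K → Packet F T) :
    Matrix (Fin M) (Fin K) F :=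
  Matrix.of fun i k => p k (Fin.castLE hMT i)

/-- The rank distribution at the destination node: the probability that the coefficient matrix of
the packets received there has rank `r`, when the batch is `x`. -/
noncomputable def rankDistribution {F : Type*} [Field F] [Fintype F] [DecidableEq F] {T M : ℕ}
    (hMT : M ≤ T) (N : ℕ) (ε : ℝ) (L : ℕ) (x : Fin M → Packet F T) (r : ℕ) : ℝ :=
  ∑ y : Fin N → Option (Packet F T),
    if (coefficientMatrix hMT (received y)).rank = r then endToEnd F T M N ε L x y else 0

/-- The mean of the rank distribution at the destination node (ranks are at most `M`). -/
noncomputable def expectedRank {F : Type*} [Field F] [Fintype F] [DecidableEq F] {T M : ℕ}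
    (hMT : M ≤ T) (N : ℕ) (ε : ℝ) (L : ℕ) (x : Fin M → Packet F T) : ℝ :=
  ∑ r ∈ Finset.range (M + 1), (r : ℝ) * rankDistribution hMT N ε L x r

/-- The achievable rate of BATS codes, in bits per use of the network. -/
noncomputable def batsRate {F : Type*} [Field F] [Fintype F] [DecidableEq F] {T M : ℕ}
    (hMT : M ≤ T) (N : ℕ) (ε : ℝ) (L : ℕ) (x : Fin M → Packet F T) : ℝ :=
  (1 - (M : ℝ) / (T : ℝ)) * (expectedRank hMT N ε L x / (N : ℝ)) *
    Real.logb 2 (Fintype.card (Packet F T) : ℝ)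

end BatchedCode

namespace BatchedCode

open Finset

variable {F : Type*} {T : ℕ}

/-! Instead of the rank, follow one symbol position `t` and the event that the packets do not all
vanish there. If they all vanish, recoding and erasures keep them zero. Otherwise each recoded
symbol is uniform on `F`, independently over channel uses, so it arrives as zero with probability `ε
+ (1 - ε) / q`. Hence the indicator is an eigenvector of one hop with eigenvalue `1 - (ε + (1 - ε) /
q) ^ N` (`sum_randomRecoding_mul_symbolIndicator`), and `L` hops give exactly its `L`-th power
(`sum_endToEnd_mul_symbolIndicator`). The rank lies between the indicator of any one row and `M`
times the sum of the row indicators, so its mean has this order up to a factor `M ^ 2`. -/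

/-- The indicator of the event that some packet has a nonzero symbol at position `t`. -/
def symbolIndicator [Field F] [DecidableEq F] {K : ℕ} (t : Fin T) (p : Fin K → Packet F T) : ℝ :=
  if ∀ k, p k t = 0 then 0 else 1

theorem symbolIndicator_nonneg [Field F] [DecidableEq F] {K : ℕ} (t : Fin T)
    (p : Fin K → Packet F T) :
    0 ≤ symbolIndicator t p := by
  unfold symbolIndicator
  split_ifs <;> simp

/-- A product over packets is the form to which independence of the channel uses applies. -/
theorem symbolIndicator_eq_one_sub_prod [Field F] [DecidableEq F] {K : ℕ}
    (t : Fin T) (p : Fin K → Packet F T) :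
    symbolIndicator t p = 1 - ∏ k, if p k t = 0 then (1 : ℝ) else 0 := by
  rw [Fintype.prod_ite_zero]
  unfold symbolIndicator
  split_ifs <;> simp

theorem symbolIndicator_of_coefficientMatrix_eq_one [Field F] [DecidableEq F] {M : ℕ}
    (hMT : M ≤ T)
    {x : Fin M → Packet F T} (hx : coefficientMatrix hMT x = 1) (i : Fin M) :
    symbolIndicator (Fin.castLE hMT i) x = 1 := by
  refine if_neg fun h => one_ne_zero (α := F) ?_
  rw [← Matrix.one_apply_eq (α := F) i, ← hx]
  exact h i

/-! ### Independence: expectations of products -/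

theorem sum_erasureChannel_mul [Fintype F] [DecidableEq F] (ε : ℝ) (v : Packet F T)
    (g : Option (Packet F T) → ℝ) :
    ∑ y, erasureChannel ε (some v) y * g y = ε * g none + (1 - ε) * g (some v) := by
  simp [Fintype.sum_option, erasureChannel]

/-- The columns of a uniform coefficient matrix are independent. -/
theorem sum_matrix_prod_col [Fintype F] {K N : ℕ} (g : (Fin K → F) → ℝ) :
    ∑ G : Matrix (Fin K) (Fin N) F, ∏ j, g (fun k => G k j) = (∑ c, g c) ^ N := by
  have h : ∑ G : Fin N → Fin K → F, ∏ j, g (G j) = (∑ c, g c) ^ N := by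
    rw [← Fintype.piFinset_univ, ← Finset.prod_univ_sum, Finset.prod_const, Finset.card_univ,
      Fintype.card_fin]
  rw [← h]
  exact Fintype.sum_equiv (Equiv.piComm _) _ _ fun G => rfl

theorem sum_erasureUses_mul_prod [Fintype F] [DecidableEq F] {N : ℕ} (ε : ℝ)
    (v : Fin N → Packet F T) (g : Option (Packet F T) → ℝ) :
    ∑ y, erasureUses F T N ε (fun j => some (v j)) y * ∏ j, g (y j) =
      ∏ j, (ε * g none + (1 - ε) * g (some (v j))) := by
  simp_rw [← sum_erasureChannel_mul, Finset.prod_univ_sum, Fintype.piFinset_univ,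
    Finset.prod_mul_distrib]
  rfl

theorem erasureUses_nonneg [DecidableEq F] {N : ℕ} {ε : ℝ} (h0 : 0 ≤ ε) (h1 : ε ≤ 1)
    (u y : Fin N → Option (Packet F T)) : 0 ≤ erasureUses F T N ε u y := by
  unfold erasureUses channelUses
  refine Finset.prod_nonneg fun j _ => ?_
  rcases u j with _ | a <;> rcases y j with _ | b <;> simp only [erasureChannel]
  · exact zero_le_one
  · exact le_rfl
  · exact h0
  · split_ifs
    · linarith
    · exact le_rfl

theorem card_matrix_eq [Fintype F] {K N : ℕ} :
    Fintype.card (Matrix (Fin K) (Fin N) F) = Fintype.card (Fin K → F) ^ N := by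
  have h : Fintype.card (Matrix (Fin K) (Fin N) F) = Fintype.card (Fin N → Fin K → F) :=
    Fintype.card_congr (Equiv.piComm fun _ _ => F)
  rw [h, Fintype.card_fun (α := Fin N), Fintype.card_fin]

/-! ### Rank against row indicators -/

theorem symbolIndicator_le_rank [Field F] [DecidableEq F] {M K : ℕ} (hMT : M ≤ T) (i : Fin M)
    (p : Fin K → Packet F T) :
    symbolIndicator (Fin.castLE hMT i) p ≤ ((coefficientMatrix hMT p).rank : ℝ) := by
  unfold symbolIndicator
  split_ifs with h
  · positivity
  · rw [Nat.one_le_cast, Nat.one_le_iff_ne_zero]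
    intro h0
    rw [Matrix.rank, Submodule.finrank_eq_zero, LinearMap.range_eq_bot] at h0
    have hC : coefficientMatrix hMT p = 0 := Matrix.ext_of_mulVec_single fun k => by
      rw [Matrix.zero_mulVec]
      exact LinearMap.congr_fun h0 _
    exact h fun k => congrFun (congrFun hC i) k

/-- Either the matrix is zero, or some row indicator is 1 and the trivial bound `M` on the rank
suffices. The factor `M` is crude but only affects the constant. -/
theorem rank_le_sum_symbolIndicator [Field F] [DecidableEq F] {M K : ℕ} (hMT : M ≤ T)
    (p : Fin K → Packet F T) :
    ((coefficientMatrix hMT p).rank : ℝ) ≤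
      M * ∑ i : Fin M, symbolIndicator (Fin.castLE hMT i) p := by
  by_cases h : coefficientMatrix hMT p = 0
  · rw [h, Matrix.rank_zero, Nat.cast_zero]
    exact mul_nonneg M.cast_nonneg (Finset.sum_nonneg fun i _ => symbolIndicator_nonneg _ p)
  · obtain ⟨i, hi⟩ : ∃ i : Fin M, ¬ ∀ k, p k (Fin.castLE hMT i) = 0 := by
      by_contra! hc
      exact h (Matrix.ext fun i k => hc i k)
    have h1 : 1 ≤ ∑ i : Fin M, symbolIndicator (Fin.castLE hMT i) p :=
      le_trans (by rw [symbolIndicator, if_neg hi]) (Finset.single_le_sum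
        (f := fun i : Fin M => symbolIndicator (Fin.castLE hMT i) p)
        (fun i _ => symbolIndicator_nonneg _ p) (Finset.mem_univ i))
    have h2 : ((coefficientMatrix hMT p).rank : ℝ) ≤ M := by
      exact_mod_cast Matrix.rank_le_height _
    nlinarith [(Nat.cast_nonneg M : (0 : ℝ) ≤ M)]

variable [Field F] [Fintype F] [DecidableEq F]

/-! ### One hop: recoding, then erasures -/

/-- A nonzero linear form on `F ^ K` vanishes on a fraction `1 / |F|` of all vectors. -/
theorem card_filter_sum_mul_eq_zero {K : ℕ} {a : Fin K → F} (ha : a ≠ 0) :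
    #{c : Fin K → F | ∑ k, c k * a k = 0} * Fintype.card F = Fintype.card (Fin K → F) := by
  classical
  obtain ⟨k, hk⟩ := Function.ne_iff.mp ha
  let φ : (Fin K → F) →ₗ[F] F := Fintype.linearCombination F a
  have hφ : ∀ c, φ c = ∑ k, c k * a k := fun c => by
    simp [φ, Fintype.linearCombination_apply]
  have hsurj : Function.Surjective φ := fun z => by
    refine ⟨Pi.single k (z / a k), ?_⟩
    have : a k ≠ 0 := hk
    rw [hφ, Finset.sum_eq_single k] <;> simp +contextual [this]
  -- The solutions form the kernel of `φ`, and the quotient by it is `F` because `φ` is onto.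
  have h1 := Submodule.card_eq_card_quotient_mul_card (LinearMap.ker φ)
  rw [Nat.card_congr (φ.quotKerEquivOfSurjective hsurj).toEquiv] at h1
  rw [← Nat.card_eq_fintype_card, ← Nat.card_eq_fintype_card, h1]
  congr 1
  rw [Nat.card_eq_fintype_card, ← Fintype.card_subtype]
  refine Fintype.card_congr (Equiv.subtypeEquivRight fun c => ?_)
  rw [LinearMap.mem_ker, hφ]

/-- Averaging over the recoding coefficients. -/
theorem sum_randomRecoding_mul {K N : ℕ} (p : Fin K → Packet F T)
    (h : (Fin N → Option (Packet F T)) → ℝ) :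
    ∑ u, randomRecoding N p u * h u =
      (∑ G : Matrix (Fin K) (Fin N) F, h fun j => some (combine G p j)) /
        (Fintype.card (Matrix (Fin K) (Fin N) F) : ℝ) := by
  classical
  have key : ∀ u : Fin N → Option (Packet F T), randomRecoding N p u * h u =
      (∑ G : Matrix (Fin K) (Fin N) F,
        if (fun j => some (combine G p j)) = u then h u else 0) /
          (Fintype.card (Matrix (Fin K) (Fin N) F) : ℝ) := fun u => by
    rw [randomRecoding, ← Finset.sum_filter, Finset.sum_const, nsmul_eq_mul,
      Fintype.card_subtype]
    ring
  rw [Finset.sum_congr rfl fun u _ => key u, ← Finset.sum_div, Finset.sum_comm]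
  simp

theorem randomRecoding_nonneg {K N : ℕ} (p : Fin K → Packet F T)
    (u : Fin N → Option (Packet F T)) : 0 ≤ randomRecoding N p u := by
  unfold randomRecoding
  positivity

/-- After the erasure channels, the symbol at position `t` is zero everywhere with a probability
that factors over the channel uses. -/
theorem sum_erasureUses_mul_symbolIndicator {N : ℕ} (ε : ℝ) (t : Fin T)
    (v : Fin N → Packet F T) :
    ∑ y, erasureUses F T N ε (fun j => some (v j)) y * symbolIndicator t (received y) =
      1 - ∏ j, (ε + (1 - ε) * if v j t = 0 then 1 else 0) := by
  -- `h1` is total mass 1; `h2` is the probability that all symbols are zero, an erasure counting as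
  -- zero.
  have h1 := sum_erasureUses_mul_prod ε v fun _ => 1
  have h2 := sum_erasureUses_mul_prod ε v fun o => if o.getD 0 t = 0 then 1 else 0
  simp only [Finset.prod_const_one, mul_one, add_sub_cancel] at h1
  simp only [Option.getD_none, Option.getD_some, Pi.zero_apply, if_true, mul_one] at h2
  simp only [symbolIndicator_eq_one_sub_prod, received, mul_sub, mul_one,
    Finset.sum_sub_distrib, h1]
  exact congrArg (1 - ·) h2

/-- The average over one column of recoding coefficients. -/
theorem sum_column {K : ℕ} (ε : ℝ) {a : Fin K → F} (ha : a ≠ 0) :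
    ∑ c : Fin K → F, (ε + (1 - ε) * if ∑ k, c k * a k = 0 then 1 else 0) =
      (Fintype.card (Fin K → F) : ℝ) * (ε + (1 - ε) / (Fintype.card F : ℝ)) := by
  have hq : (Fintype.card F : ℝ) ≠ 0 := by positivity
  have h : (#{c : Fin K → F | ∑ k, c k * a k = 0} : ℝ) * Fintype.card F =
      Fintype.card (Fin K → F) := by exact_mod_cast card_filter_sum_mul_eq_zero ha
  rw [Finset.sum_add_distrib, ← Finset.mul_sum, Finset.sum_boole, Finset.sum_const, nsmul_eq_mul,
    Finset.card_univ, ← h]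
  field_simp

/-- One hop of recoding followed by transmission multiplies the probability that the symbols at
position `t` are not all zero by `1 - (ε + (1 - ε) / q) ^ N`. -/
theorem sum_randomRecoding_mul_symbolIndicator {K N : ℕ} (ε : ℝ) (t : Fin T)
    (p : Fin K → Packet F T) :
    ∑ u, randomRecoding N p u * ∑ y, erasureUses F T N ε u y * symbolIndicator t (received y) =
      (1 - (ε + (1 - ε) / (Fintype.card F : ℝ)) ^ N) * symbolIndicator t p := by
  have hcard : (Fintype.card (Fin K → F) : ℝ) ^ N ≠ 0 := by positivity
  rw [sum_randomRecoding_mul]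
  simp only [sum_erasureUses_mul_symbolIndicator]
  rw [Finset.sum_sub_distrib, Finset.sum_const, nsmul_eq_mul, Finset.card_univ, card_matrix_eq]
  have hG : ∑ G : Matrix (Fin K) (Fin N) F,
      ∏ j, (ε + (1 - ε) * if combine G p j t = 0 then 1 else 0) =
        (∑ c : Fin K → F, (ε + (1 - ε) * if ∑ k, c k * p k t = 0 then 1 else 0)) ^ N := by
    rw [← sum_matrix_prod_col]
    simp [combine, Finset.sum_apply]
  rw [hG]
  -- If all symbols vanish, every factor is `ε + (1 - ε) = 1` and both sides are 0.
  by_cases ha : ∀ k, p k t = 0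
  · simp [symbolIndicator, ha]
  · rw [sum_column ε (a := fun k => p k t) fun h => ha (congrFun h)]
    simp only [symbolIndicator, ha, if_false, Nat.cast_pow]
    rw [mul_pow]
    field_simp

/-! ### Iterating the eigenvector relation along the line -/

open Matrix in
theorem source_mulVec_symbolIndicator {M N : ℕ} (ε : ℝ) (t : Fin T) :
    (sourceRecoding F T M N * erasureUses F T N ε) *ᵥ (fun y => symbolIndicator t (received y)) =
      (1 - (ε + (1 - ε) / (Fintype.card F : ℝ)) ^ N) • fun x => symbolIndicator t x := by
  rw [← Matrix.mulVec_mulVec]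
  exact funext fun x => sum_randomRecoding_mul_symbolIndicator ε t x

open Matrix in
theorem node_mulVec_symbolIndicator {N : ℕ} (ε : ℝ) (t : Fin T) :
    (nodeRecoding F T N * erasureUses F T N ε) *ᵥ (fun y => symbolIndicator t (received y)) =
      (1 - (ε + (1 - ε) / (Fintype.card F : ℝ)) ^ N) •
        fun y => symbolIndicator t (received y) := by
  rw [← Matrix.mulVec_mulVec]
  exact funext fun y => sum_randomRecoding_mul_symbolIndicator ε t (received y)

open Matrix in
theorem pow_mulVec_eq_smul {ι : Type*} [Fintype ι] [DecidableEq ι] {W : Matrix ι ι ℝ} {f : ι → ℝ}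
    {r : ℝ} (h : W *ᵥ f = r • f) (n : ℕ) : (W ^ n) *ᵥ f = r ^ n • f := by
  induction n with
  | zero => simp
  | succ n ih => rw [pow_succ, ← Matrix.mulVec_mulVec, h, Matrix.mulVec_smul, ih, smul_smul,
      pow_succ']

/-- The probability that the symbols at position `t` received at the destination are not all
zero. -/
theorem sum_endToEnd_mul_symbolIndicator {M N L : ℕ} (hL : 1 ≤ L) (ε : ℝ) (t : Fin T)
    (x : Fin M → Packet F T) :
    ∑ y, endToEnd F T M N ε L x y * symbolIndicator t (received y) =
      (1 - (ε + (1 - ε) / (Fintype.card F : ℝ)) ^ N) ^ L * symbolIndicator t x := by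
  have h : (endToEnd F T M N ε L).mulVec (fun y => symbolIndicator t (received y)) =
      (1 - (ε + (1 - ε) / (Fintype.card F : ℝ)) ^ N) ^ L • fun x => symbolIndicator t x := by
    -- The `L - 1` intermediate hops and the source hop contribute `L` equal factors.
    rw [endToEnd, ← Matrix.mulVec_mulVec,
      pow_mulVec_eq_smul (node_mulVec_symbolIndicator (F := F) (N := N) ε t), Matrix.mulVec_smul,
      source_mulVec_symbolIndicator, smul_smul, ← pow_succ, Nat.sub_add_cancel hL]
  exact congrFun h x

/-! ### From the indicators to the expected rank -/

theorem matrix_mul_nonneg {l m n : Type*} [Fintype m] {A : Matrix l m ℝ} {B : Matrix m n ℝ}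
    (hA : ∀ i j, 0 ≤ A i j) (hB : ∀ i j, 0 ≤ B i j) (i : l) (j : n) : 0 ≤ (A * B) i j :=
  Finset.sum_nonneg fun k _ => mul_nonneg (hA i k) (hB k j)

theorem matrix_pow_nonneg {m : Type*} [Fintype m] [DecidableEq m] {A : Matrix m m ℝ}
    (hA : ∀ i j, 0 ≤ A i j) (n : ℕ) : ∀ i j, 0 ≤ (A ^ n) i j := by
  induction n with
  | zero => intro i j; rw [pow_zero, Matrix.one_apply]; split_ifs <;> simp
  | succ n ih => rw [pow_succ]; exact matrix_mul_nonneg ih hA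

/-- Lets pointwise bounds on the rank pass to its mean. -/
theorem endToEnd_nonneg {M N L : ℕ} {ε : ℝ} (h0 : 0 ≤ ε) (h1 : ε ≤ 1) (x : Fin M → Packet F T)
    (y : Fin N → Option (Packet F T)) : 0 ≤ endToEnd F T M N ε L x y :=
  matrix_mul_nonneg
    (matrix_mul_nonneg (fun x u => randomRecoding_nonneg x u) (erasureUses_nonneg h0 h1))
    (matrix_pow_nonneg (matrix_mul_nonneg (fun y u => randomRecoding_nonneg (received y) u)
      (erasureUses_nonneg h0 h1)) _) x y

theorem expectedRank_eq_sum {M : ℕ} (hMT : M ≤ T) (N : ℕ) (ε : ℝ) (L : ℕ)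
    (x : Fin M → Packet F T) :
    expectedRank hMT N ε L x = ∑ y : Fin N → Option (Packet F T),
      endToEnd F T M N ε L x y * ((coefficientMatrix hMT (received y)).rank : ℝ) := by
  simp only [expectedRank, rankDistribution, Finset.mul_sum]
  rw [Finset.sum_comm]
  refine Finset.sum_congr rfl fun y _ => ?_
  have hr : (coefficientMatrix hMT (received y)).rank ∈ Finset.range (M + 1) :=
    Finset.mem_range.mpr (Nat.lt_succ_of_le (Matrix.rank_le_height _))
  rw [Finset.sum_eq_single_of_mem _ hr fun r _ hne => by rw [if_neg hne.symm, mul_zero],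
    if_pos rfl, mul_comm]

theorem le_expectedRank {M N L : ℕ} (hM : 1 ≤ M) (hMT : M ≤ T) (hL : 1 ≤ L) {ε : ℝ} (h0 : 0 ≤ ε)
    (h1 : ε ≤ 1) {x : Fin M → Packet F T} (hx : coefficientMatrix hMT x = 1) :
    (1 - (ε + (1 - ε) / (Fintype.card F : ℝ)) ^ N) ^ L ≤ expectedRank hMT N ε L x := by
  have h := sum_endToEnd_mul_symbolIndicator (N := N) hL ε (Fin.castLE hMT ⟨0, hM⟩) x
  rw [symbolIndicator_of_coefficientMatrix_eq_one hMT hx, mul_one] at h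
  rw [← h, expectedRank_eq_sum]
  exact Finset.sum_le_sum fun y _ => mul_le_mul_of_nonneg_left
    (symbolIndicator_le_rank hMT _ _) (endToEnd_nonneg h0 h1 x y)

/-- One factor `M` comes from the rank bound, the other from summing over the `M` rows. -/
theorem expectedRank_le {M N L : ℕ} (hMT : M ≤ T) (hL : 1 ≤ L) {ε : ℝ} (h0 : 0 ≤ ε)
    (h1 : ε ≤ 1) {x : Fin M → Packet F T} (hx : coefficientMatrix hMT x = 1) :
    expectedRank hMT N ε L x ≤
      (M : ℝ) ^ 2 * (1 - (ε + (1 - ε) / (Fintype.card F : ℝ)) ^ N) ^ L := by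
  rw [expectedRank_eq_sum]
  calc _ ≤ ∑ y : Fin N → Option (Packet F T), endToEnd F T M N ε L x y *
        (M * ∑ i : Fin M, symbolIndicator (Fin.castLE hMT i) (received y)) :=
        Finset.sum_le_sum fun y _ => mul_le_mul_of_nonneg_left
          (rank_le_sum_symbolIndicator hMT _) (endToEnd_nonneg h0 h1 x y)
    _ = M * ∑ i : Fin M, ∑ y : Fin N → Option (Packet F T), endToEnd F T M N ε L x y *
        symbolIndicator (Fin.castLE hMT i) (received y) := by
        rw [Finset.sum_comm, Finset.mul_sum]
        refine Finset.sum_congr rfl fun y _ => ?_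
        rw [← Finset.mul_sum]
        ring
    _ = _ := by
        simp only [sum_endToEnd_mul_symbolIndicator hL,
          symbolIndicator_of_coefficientMatrix_eq_one hMT hx, mul_one, Finset.sum_const,
          Finset.card_univ, Fintype.card_fin, nsmul_eq_mul]
        ring

end BatchedCode

theorem theorem4 (F : Type*) [Field F] [Fintype F] [DecidableEq F] (ε : ℝ) (hε0 : 0 < ε)
    (hε1 : ε < 1) (T M : ℕ) (hM : 1 ≤ M) (hMT : M < T) :
    ∃ c C : ℝ, 0 < c ∧ 0 < C ∧
      ∀ (L N : ℕ), 1 ≤ L → 1 ≤ N →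
        ∀ x : Fin M → BatchedCode.Packet F T,
          BatchedCode.coefficientMatrix hMT.le x = 1 →
            c * ((1 - (ε + (1 - ε) / (Fintype.card F : ℝ)) ^ N) ^ L / (N : ℝ))
                ≤ BatchedCode.batsRate hMT.le N ε L x ∧
            BatchedCode.batsRate hMT.le N ε L x
                ≤ C * ((1 - (ε + (1 - ε) / (Fintype.card F : ℝ)) ^ N) ^ L / (N : ℝ)) := by
  have hT : 0 < T := by omega
  have hM' : (0 : ℝ) < M := by exact_mod_cast hM
  have hfrac : 0 < 1 - (M : ℝ) / (T : ℝ) := by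
    rw [sub_pos, div_lt_one (by exact_mod_cast hT)]
    exact_mod_cast hMT
  have hlog : 0 < Real.logb 2 (Fintype.card (BatchedCode.Packet F T) : ℝ) := by
    have : NeZero T := ⟨hT.ne'⟩
    refine Real.logb_pos one_lt_two ?_
    exact_mod_cast Fintype.one_lt_card
  set a := 1 - (M : ℝ) / (T : ℝ)
  set b := Real.logb 2 (Fintype.card (BatchedCode.Packet F T) : ℝ)
  -- The rate is `a * b` times the expected rank over `N`, so the constants are `a * b` times those
  -- of the rank bounds, 1 and `M ^ 2`.
  refine ⟨a * b, a * b * (M : ℝ) ^ 2, by positivity, by positivity, fun L N hL hN x hx => ?_⟩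
  have hrate : BatchedCode.batsRate hMT.le N ε L x =
      a * b * (BatchedCode.expectedRank hMT.le N ε L x / N) := by
    rw [BatchedCode.batsRate]
    ring
  rw [hrate, mul_assoc (a * b), ← mul_div_assoc ((M : ℝ) ^ 2)]
  constructor
  · gcongr
    exact BatchedCode.le_expectedRank hM hMT.le hL hε0.le hε1.le hx
  · gcongr
    exact BatchedCode.expectedRank_le hMT.le hL hε0.le hε1.le hx
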